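/- Let $M$ be a nonempty finite set of vectors $\eta\in\{0,1\}^m$ ($\eta(i)=1$ meaning that the dichotomy $\eta$ misclassifies the training example $x_i$), let $\Delta_m=\{w\in\mathbb R^m : w(i)\ge 0,\ \sum_i w(i)=1\}$, and let $\mathrm{AdaSelect}$ be a tie-breaking rule assigning to every nonempty subset of $M$ one of its elements. For $w\in\Delta_m$ put $\epsilon(w)=\min_{\eta\in M}\eta\cdot w$, $\alpha(w)=\frac12\log\frac{1-\epsilon(w)}{\epsilon(w)}$ and $\eta^w=\mathrm{AdaSelect}(\arg\min_{\eta\in M}\eta\cdot w)$. Let $\sigma_0=\{w\in\Delta_m : \eta\cdot w>0\ \text{for all }\eta\in M\}$, and for $w\in\sigma_0$ let the Optimal AdaBoost update $\mathcal A(w)$ be given by $$[\mathcal A(w)]_i=\tfrac12\,w(i)\Bigl(\tfrac1{\eta\cdot w}\Bigr)^{\eta(i)}\Bigl(\tfrac1{1-\eta\cdot w}\Bigr)^{1-\eta(i)},\qquad \eta=\eta^w .$$ Let $\Omega_\infty=\bigcap_{t\ge1}\mathcal A^{(t)}(\sigma_0)$, the set of weights that can be reached after any number $t$ of updates, and for $\eta\in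 M$ let $\sigma(\eta)=\{w\in\Delta_m : \eta\in\arg\min_{\eta'\in M}\eta'\cdot w\}$. Assume: 1. (weak learning) there is $\gamma>0$ with $\epsilon(w)<\frac12-\gamma$ for all $w\in\Delta_m$; 2. (no ties eventually) there is a compact set $G\subseteq\Delta_m$ with $\Omega_\infty\subseteq G$ such that for all $\eta,\eta'\in M$ either $\sigma(\eta)\cap\sigma(\eta')\cap G=\emptyset$, or $\sum_{i:\eta(i)\ne\eta'(i)}w(i)=0$ for all $w\in G$; 3. $\Omega_\infty\neq\emptyset$. Then there exists an $\mathcal A$-invariant Borel probability measure $\mu$ with $\mu(\sigma_0)=1$. Moreover, for every such measure $\mu$ and for $\mu$-almost every initial weight $w_1$, the following holds for the trajectory $w_t=\mathcal A^{(t-1)}(w_1)$, with $\alpha_t=\alpha(w_t)$ and $\eta_t=\eta^{w_t}$. There is a probability distribution $(\tilde C_\eta)_{\eta\in M}$ on the rows of $M$ such that for every training example $x_i$ the margin $$\mathrm{margin}_T(x_i)=F_T(x_i)\Bigl(\sum_{t=1}^T\alpha_t\Bigr)^{-1},\qquad F_T(x_i)=\sum_{t=1}^T 2\alpha_t(\eta_t(i)-1),$$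 converges as $T\to\infty$, with limit $\sum_{\eta\in M}2\tilde C_\eta(\eta(i)-1)$; and, likewise, the signed margin for $\pm1$-valued hypotheses, $\bigl(\sum_{t=1}^T\alpha_t(1-2\eta_t(i))\bigr)\bigl(\sum_{t=1}^T\alpha_t\bigr)^{-1}$, converges to $\sum_{\eta\in M}\tilde C_\eta(1-2\eta(i))$. -/

import Mathlib

open MeasureTheory Filter Topology

noncomputable section

namespace AdaBoost

/-- A dichotomy (a row of the error matrix) on `m` training examples: a 0-1 vector,
with `η i = 1` when the `i`-th example is misclassified. -/
abbrev Row (m : ℕ) := Fin m → Fin 2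

variable {m : ℕ}

/-- The entry `η i` as a real number. -/
def Row.val (η : Row m) (i : Fin m) : ℝ := ((η i : ℕ) : ℝ)

/-- The weighted error `η · w`. -/
def err (η : Row m) (w : Fin m → ℝ) : ℝ := ∑ i, η.val i * w i

open Classical in
/-- The set of rows of `M` of minimal weighted error. -/
def argminRows (M : Finset (Row m)) (w : Fin m → ℝ) : Finset (Row m) :=
  M.filter fun η => ∀ η' ∈ M, err η w ≤ err η' w

/-- A tie-breaking function: it picks an element of every nonempty subset of `M`. -/
def IsAdaSelect (M : Finset (Row m)) (sel : Finset (Row m) → Row m) : Prop :=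
  ∀ s ⊆ M, s.Nonempty → sel s ∈ s

/-- The row `η^w` selected at the weight `w`. -/
def bestRow (M : Finset (Row m)) (sel : Finset (Row m) → Row m) (w : Fin m → ℝ) : Row m :=
  sel (argminRows M w)

/-- The closed region of weights in the simplex at which `η` has minimal error. -/
def region (M : Finset (Row m)) (η : Row m) : Set (Fin m → ℝ) :=
  {w | w ∈ stdSimplex ℝ (Fin m) ∧ η ∈ argminRows M w}

/-- The weights in the simplex at which every row of `M` has positive error. -/
def posErr (M : Finset (Row m)) : Set (Fin m → ℝ) :=
  {w | w ∈ stdSimplex ℝ (Fin m) ∧ ∀ η ∈ M, 0 < err η w}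

/-- The hypothetical weight update, were `η` the selected row. -/
def hypUpdate (η : Row m) (w : Fin m → ℝ) : Fin m → ℝ := fun i =>
  1 / 2 * w i * (1 / err η w) ^ (η i : ℕ) * (1 / (1 - err η w)) ^ (1 - (η i : ℕ))

/-- The AdaBoost weight update. It divides by the error of the selected row, so it is meaningful
at the weights in `posErr M`, and it is only ever used there. -/
def update (M : Finset (Row m)) (sel : Finset (Row m) → Row m) (w : Fin m → ℝ) : Fin m → ℝ :=
  hypUpdate (bestRow M sel w) w

/-- The minimal weighted error. -/
def minErr (M : Finset (Row m)) (hM : M.Nonempty) (w : Fin m → ℝ) : ℝ :=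
  M.inf' hM fun η => err η w

/-- The coefficient given to the row selected at the weight `w`. -/
def coeff (M : Finset (Row m)) (hM : M.Nonempty) (w : Fin m → ℝ) : ℝ :=
  1 / 2 * Real.log ((1 - minErr M hM w) / minErr M hM w)

/-- The weak learning assumption: at every weight some row beats random guessing by a fixed
amount. -/
def WeakLearning (M : Finset (Row m)) : Prop :=
  ∃ γ : ℝ, 0 < γ ∧ ∀ w ∈ stdSimplex ℝ (Fin m), ∃ η ∈ M, err η w < 1 / 2 - γ

/-- The non-transient states: the weights that, for every `t ≥ 1`, are reached after `t` updates.
The points of the simplex from which `t` updates can be carried out without dividing by zero are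
those of `posErr M`. -/
def limitSet (M : Finset (Row m)) (sel : Finset (Row m) → Row m) : Set (Fin m → ℝ) :=
  ⋂ t ∈ Set.Ici (1 : ℕ), (update M sel)^[t] '' posErr M

/-- The assumption that AdaBoost eventually has no ties. -/
def NoTies (M : Finset (Row m)) (sel : Finset (Row m) → Row m) : Prop :=
  ∃ G : Set (Fin m → ℝ), G ⊆ stdSimplex ℝ (Fin m) ∧ IsCompact G ∧ limitSet M sel ⊆ G ∧
    ∀ η ∈ M, ∀ η' ∈ M,
      region M η ∩ region M η' ∩ G = ∅ ∨
      ∀ w ∈ G, ∑ i with η i ≠ η' i, w i = 0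

/-- An invariant Borel probability measure of AdaBoost, carried by the weights in the simplex at
which the update is defined. -/
structure IsInvariant (M : Finset (Row m)) (sel : Finset (Row m) → Row m)
    (μ : Measure (Fin m → ℝ)) : Prop where
  prob : IsProbabilityMeasure μ
  carried : ∀ᵐ w ∂μ, w ∈ posErr M
  preserving : MeasurePreserving (update M sel) μ μ

/-- `w_{t+1}`, the weight after `t` updates of the initial weight `w`. -/
def weight (M : Finset (Row m)) (sel : Finset (Row m) → Row m) (w : Fin m → ℝ) (t : ℕ) :
    Fin m → ℝ :=
  (update M sel)^[t] w

/-- The sum of the coefficients of the first `T` rounds. -/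
def coeffSum (M : Finset (Row m)) (hM : M.Nonempty) (sel : Finset (Row m) → Row m)
    (w : Fin m → ℝ) (T : ℕ) : ℝ :=
  ∑ t ∈ Finset.range T, coeff M hM (weight M sel w t)

/-- `F_T(x_i) = ∑ 2 α_t (η_t(i) - 1)`, for the initial weight `w`. -/
def score (M : Finset (Row m)) (hM : M.Nonempty) (sel : Finset (Row m) → Row m)
    (w : Fin m → ℝ) (T : ℕ) (i : Fin m) : ℝ :=
  ∑ t ∈ Finset.range T, 2 * coeff M hM (weight M sel w t) *
    ((bestRow M sel (weight M sel w t)).val i - 1)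

/-- `margin_T(x_i)`. -/
def margin (M : Finset (Row m)) (hM : M.Nonempty) (sel : Finset (Row m) → Row m)
    (w : Fin m → ℝ) (T : ℕ) (i : Fin m) : ℝ :=
  score M hM sel w T i * (coeffSum M hM sel w T)⁻¹

/-- The same margin for `±1`-valued hypotheses: `y_i ∑ α_t h_t(x_i) / ∑ α_t`, where
`y_i h_t(x_i) = 1 - 2 η_t(i)` is `1` if the round-`t` hypothesis is right about `x_i`, else `-1`. -/
def signedMargin (M : Finset (Row m)) (hM : M.Nonempty) (sel : Finset (Row m) → Row m)
    (w : Fin m → ℝ) (T : ℕ) (i : Fin m) : ℝ :=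
  (∑ t ∈ Finset.range T, coeff M hM (weight M sel w t) *
    (1 - 2 * (bestRow M sel (weight M sel w t)).val i)) * (coeffSum M hM sel w T)⁻¹

end AdaBoost

end

/-! Every update multiplies each weight by at least 1/2 and gives the selected row error 1/2. By
pigeonhole over `M.card + 1` rounds, all errors are then bounded below after `M.card` updates
(`pow_le_err_weight_card`), uniformly in the initial weight. Existence: this closed condition passes
to the closure of the limit set, a compact invariant set on which the absence of ties makes the
update continuous (`continuousOn_update`), so Krylov–Bogoliubov applies. Convergence: under an
invariant measure the same bound holds almost everywhere, so the coefficients are essentially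
bounded, and weak learning keeps them above a positive constant. Birkhoff's theorem for each
`rowCoeff` gives limits `L η` with positive sum. Both margins are ratios of averages of these
functions, so they converge, with row weights `L η` divided by their sum. -/

/-! ### Birkhoff's ergodic theorem via the maximal inequality. -/

section Birkhoff

variable {α : Type*} {T : α → α} {g : α → ℝ}

/-- The running maximum of the Birkhoff sums `birkhoffSum T g k`, `k ≤ n`. -/
def birkhoffMax (T : α → α) (g : α → ℝ) : ℕ → α → ℝ
  | 0 => fun _ => 0
  | n + 1 => fun x => max 0 (g x + birkhoffMax T g n (T x))

theorem birkhoffMax_nonneg (n : ℕ) (x : α) : 0 ≤ birkhoffMax T g n x := by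
  cases n with
  | zero => exact le_rfl
  | succ n => exact le_max_left _ _

theorem birkhoffMax_le_succ (n : ℕ) (x : α) :
    birkhoffMax T g n x ≤ birkhoffMax T g (n + 1) x := by
  induction n generalizing x with
  | zero => exact birkhoffMax_nonneg 1 x
  | succ n ih => exact max_le_max le_rfl (by linarith [ih (T x)])

theorem birkhoffSum_le_birkhoffMax (n : ℕ) (x : α) :
    birkhoffSum T g n x ≤ birkhoffMax T g n x := by
  induction n generalizing x with
  | zero => simp [birkhoffMax]
  | succ n ih =>
    rw [birkhoffSum_succ']
    exact le_max_of_le_right (by linarith [ih (T x)])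

/-- Where the maximum is positive it equals its second argument; elsewhere the left side is at most
0. Integrated against an invariant measure, the two maxima compare and leave the maximal ergodic
theorem. -/
theorem birkhoffMax_succ_le (n : ℕ) (x : α) :
    birkhoffMax T g (n + 1) x ≤
      {y | 0 < birkhoffMax T g (n + 1) y}.indicator g x + birkhoffMax T g n (T x) := by
  by_cases hx : 0 < birkhoffMax T g (n + 1) x
  · rw [Set.indicator_of_mem (by exact hx)]
    refine max_le (le_of_not_gt fun h => ?_) le_rfl
    exact hx.ne' (max_eq_left h.le)
  · rw [Set.indicator_of_notMem (by exact hx), zero_add]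
    exact (not_lt.1 hx).trans (birkhoffMax_nonneg n _)

variable [MeasurableSpace α] {μ : Measure α}

theorem measurable_birkhoffMax (hT : Measurable T) (hg : Measurable g) (n : ℕ) :
    Measurable (birkhoffMax T g n) := by
  induction n with
  | zero => exact measurable_const
  | succ n ih => exact measurable_const.max (hg.add (ih.comp hT))

theorem integrable_birkhoffMax (hT : MeasurePreserving T μ μ) (hg : Integrable g μ) (n : ℕ) :
    Integrable (birkhoffMax T g n) μ := by
  induction n with
  | zero => exact integrable_zero _ _ _
  | succ n ih => exact (integrable_zero _ _ _).sup (hg.add (hT.integrable_comp_of_integrable ih))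

/-- The maximal ergodic theorem. -/
theorem MeasureTheory.MeasurePreserving.setIntegral_birkhoffMax_nonneg
    (hT : MeasurePreserving T μ μ) (hgm : Measurable g) (hg : Integrable g μ) (n : ℕ) :
    0 ≤ ∫ x in {y | 0 < birkhoffMax T g (n + 1) y}, g x ∂μ := by
  have hms : MeasurableSet {y | 0 < birkhoffMax T g (n + 1) y} :=
    measurableSet_lt measurable_const (measurable_birkhoffMax hT.measurable hgm _)
  have hi := integrable_birkhoffMax hT hg n
  have hc : ∫ x, birkhoffMax T g n (T x) ∂μ = ∫ x, birkhoffMax T g n x ∂μ := by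
    rw [← integral_map hT.measurable.aemeasurable, hT.map_eq]
    rw [hT.map_eq]; exact hi.aestronglyMeasurable
  have h1 : ∫ x, birkhoffMax T g (n + 1) x ∂μ ≤
      ∫ x, ({y | 0 < birkhoffMax T g (n + 1) y}.indicator g x + birkhoffMax T g n (T x)) ∂μ :=
    integral_mono (integrable_birkhoffMax hT hg _)
      ((hg.indicator hms).add (hT.integrable_comp_of_integrable hi)) (birkhoffMax_succ_le n)
  have h2 : ∫ x, birkhoffMax T g n x ∂μ ≤ ∫ x, birkhoffMax T g (n + 1) x ∂μ :=
    integral_mono hi (integrable_birkhoffMax hT hg _) (birkhoffMax_le_succ n)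
  have h3 := integral_add (hg.indicator hms) (hT.integrable_comp_of_integrable hi)
  simp only [Function.comp_apply] at h3
  rw [h3, hc, integral_indicator hms] at h1
  linarith

theorem MeasureTheory.MeasurePreserving.integral_nonneg_of_birkhoffSum_pos
    (hT : MeasurePreserving T μ μ) (hgm : Measurable g) (hg : Integrable g μ)
    (h : ∀ᵐ x ∂μ, ∃ n, 0 < birkhoffSum T g n x) : 0 ≤ ∫ x, g x ∂μ := by
  set A : ℕ → Set α := fun n => {y | 0 < birkhoffMax T g (n + 1) y}
  have hA : ∀ n, MeasurableSet (A n) := fun n =>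
    measurableSet_lt measurable_const (measurable_birkhoffMax hT.measurable hgm _)
  have hmono : Monotone A := monotone_nat_of_le_succ fun n x hx =>
    lt_of_lt_of_le hx (birkhoffMax_le_succ _ x)
  have hlim := tendsto_setIntegral_of_monotone hA hmono hg.integrableOn (f := g) (μ := μ)
  have hU : (⋃ n, A n) =ᵐ[μ] Set.univ := by
    refine eventuallyEq_univ.2 ?_
    filter_upwards [h] with x ⟨n, hn⟩
    exact Set.mem_iUnion.2 ⟨n, (hn.trans_le (birkhoffSum_le_birkhoffMax n x)).trans_le
      (birkhoffMax_le_succ n x)⟩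
  rw [setIntegral_congr_set hU, setIntegral_univ] at hlim
  exact ge_of_tendsto' hlim fun n => hT.setIntegral_birkhoffMax_nonneg hgm hg n

/-- The rational strictly below `a` encodes `liminf < a`: the gap absorbs a perturbation tending to
0, and countability gives measurability. -/
theorem exists_lt_frequently_lt_of_tendsto_sub {u v : ℕ → ℝ} {a : ℝ}
    (huv : Tendsto (fun n => u n - v n) atTop (𝓝 0))
    (h : ∃ q : ℚ, (q : ℝ) < a ∧ ∃ᶠ n in atTop, v n < q) :
    ∃ q : ℚ, (q : ℝ) < a ∧ ∃ᶠ n in atTop, u n < q := by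
  obtain ⟨q, hq, hf⟩ := h
  obtain ⟨r, hqr, hra⟩ := exists_rat_btwn hq
  refine ⟨r, hra, (hf.and_eventually (huv.eventually_lt_const (sub_pos.2 hqr))).mono ?_⟩
  rintro n ⟨h1, h2⟩
  linarith

theorem measurableSet_exists_lt_frequently_lt {u : ℕ → α → ℝ} (hu : ∀ n, Measurable (u n))
    (a : ℝ) : MeasurableSet {x | ∃ q : ℚ, (q : ℝ) < a ∧ ∃ᶠ n in atTop, u n x < q} := by
  simp only [frequently_atTop]
  refine measurableSet_setOfPred.2 (Measurable.exists fun q => measurable_const.and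
    (Measurable.forall fun N => Measurable.exists fun n => measurable_const.and ?_))
  exact measurableSet_setOfPred.1 (measurableSet_lt (hu n) measurable_const)

theorem measurable_birkhoffAverage (hT : Measurable T) (hg : Measurable g) (n : ℕ) :
    Measurable (birkhoffAverage ℝ T g n) := by
  unfold birkhoffAverage birkhoffSum
  exact (Finset.measurable_fun_sum _ fun k _ => hg.comp (hT.iterate k)).const_smul (n : ℝ)⁻¹

/-- Almost every point has Birkhoff averages that cross the gap `a < b` only finitely often. -/
theorem MeasureTheory.MeasurePreserving.ae_not_birkhoffAverage_upcrossing [IsFiniteMeasure μ]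
    (hT : MeasurePreserving T μ μ) (hgm : Measurable g) {C : ℝ} (hC : ∀ x, |g x| ≤ C) {a b : ℝ}
    (hab : a < b) :
    ∀ᵐ x ∂μ, ¬((∃ q : ℚ, (q : ℝ) < a ∧ ∃ᶠ n in atTop, birkhoffAverage ℝ T g n x < q) ∧
      ∃ q : ℚ, (q : ℝ) < -b ∧ ∃ᶠ n in atTop, birkhoffAverage ℝ T (-g) n x < q) := by
  set E₁ := {x | ∃ q : ℚ, (q : ℝ) < a ∧ ∃ᶠ n in atTop, birkhoffAverage ℝ T g n x < q}
  set E₂ := {x | ∃ q : ℚ, (q : ℝ) < -b ∧ ∃ᶠ n in atTop, birkhoffAverage ℝ T (-g) n x < q}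
  have hCn : ∀ x, |(-g) x| ≤ C := by simpa using hC
  have hE : MeasurableSet (E₁ ∩ E₂) :=
    (measurableSet_exists_lt_frequently_lt (measurable_birkhoffAverage hT.measurable hgm) a).inter
      (measurableSet_exists_lt_frequently_lt
        (measurable_birkhoffAverage hT.measurable hgm.neg) (-b))
  have hsub : ∀ (f : α → ℝ), (∀ x, |f x| ≤ C) → ∀ x, Tendsto (fun n =>
      birkhoffAverage ℝ T f n (T x) - birkhoffAverage ℝ T f n x) atTop (𝓝 0) := fun f hf x =>
    tendsto_birkhoffAverage_apply_sub_birkhoffAverage ℝ (isBounded_iff_forall_norm_le.2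
      ⟨C, by rintro _ ⟨n, rfl⟩; exact hf _⟩)
  have hsub' : ∀ (f : α → ℝ), (∀ x, |f x| ≤ C) → ∀ x, Tendsto (fun n =>
      birkhoffAverage ℝ T f n x - birkhoffAverage ℝ T f n (T x)) atTop (𝓝 0) := fun f hf x => by
    simpa using (hsub f hf x).neg
  -- The averages at `x` and `T x` differ by a null sequence, so the crossing set is invariant and
  -- the maximal theorem applies to the restricted measure.
  have hinv : T ⁻¹' (E₁ ∩ E₂) = E₁ ∩ E₂ := by
    ext x
    constructor
    · rintro ⟨h1, h2⟩
      exact ⟨exists_lt_frequently_lt_of_tendsto_sub (hsub' g hC x) h1,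
        exists_lt_frequently_lt_of_tendsto_sub (hsub' (-g) hCn x) h2⟩
    · rintro ⟨h1, h2⟩
      exact ⟨exists_lt_frequently_lt_of_tendsto_sub (hsub g hC x) h1,
        exists_lt_frequently_lt_of_tendsto_sub (hsub (-g) hCn x) h2⟩
  have hTE : MeasurePreserving T (μ.restrict (E₁ ∩ E₂)) (μ.restrict (E₁ ∩ E₂)) := by
    have := hT.restrict_preimage hE
    rwa [hinv] at this
  have hgi : Integrable g (μ.restrict (E₁ ∩ E₂)) :=
    Integrable.of_bound hgm.aestronglyMeasurable C (Eventually.of_forall hC)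
  have key : ∀ (f : α → ℝ) (c : ℝ) (x : α),
      (∃ q : ℚ, (q : ℝ) < c ∧ ∃ᶠ n in atTop, birkhoffAverage ℝ T f n x < q) →
      ∃ n, 0 < birkhoffSum T (fun y => c - f y) n x := by
    rintro f c x ⟨q, hq, hf⟩
    obtain ⟨n, hn, hn1⟩ := (hf.and_eventually (eventually_ge_atTop 1)).exists
    have hn0 : (0 : ℝ) < n := by exact_mod_cast hn1
    refine ⟨n, ?_⟩
    rw [birkhoffAverage, smul_eq_mul, inv_mul_lt_iff₀ hn0] at hn
    have : birkhoffSum T (fun y => c - f y) n x = n * c - birkhoffSum T f n x := by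
      simp [birkhoffSum]
    rw [this]
    nlinarith
  -- With `E = E₁ ∩ E₂`, these give `b * μ E ≤ ∫ g ≤ a * μ E` over `E`; as `a < b`, `E` is null.
  have h1 := hTE.integral_nonneg_of_birkhoffSum_pos (g := fun y => a - g y)
    (measurable_const.sub hgm) ((integrable_const _).sub hgi)
    ((ae_restrict_mem hE).mono fun x hx => key g a x hx.1)
  have h2 := hTE.integral_nonneg_of_birkhoffSum_pos (g := fun y => -b - (-g) y)
    (measurable_const.sub hgm.neg) ((integrable_const _).sub hgi.neg)
    ((ae_restrict_mem hE).mono fun x hx => key (-g) (-b) x hx.2)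
  rw [integral_sub (integrable_const _) hgi] at h1
  rw [integral_sub (integrable_const _) hgi.neg] at h2
  simp only [Pi.neg_apply, integral_neg, integral_const, smul_eq_mul] at h1 h2
  have h0 : (μ.restrict (E₁ ∩ E₂)).real Set.univ = 0 := by
    have : 0 ≤ (μ.restrict (E₁ ∩ E₂)).real Set.univ := measureReal_nonneg
    nlinarith
  rw [measureReal_restrict_apply_univ, measureReal_eq_zero_iff] at h0
  exact measure_eq_zero_iff_ae_notMem.1 h0

theorem MeasureTheory.MeasurePreserving.ae_exists_tendsto_birkhoffAverage_of_forall_le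
    [IsFiniteMeasure μ] (hT : MeasurePreserving T μ μ) (hgm : Measurable g) {C : ℝ}
    (hC : ∀ x, |g x| ≤ C) :
    ∀ᵐ x ∂μ, ∃ l, Tendsto (fun n => birkhoffAverage ℝ T g n x) atTop (𝓝 l) := by
  have h : ∀ᵐ x ∂μ, ∀ a b : ℚ, (a : ℝ) < b →
      ¬((∃ q : ℚ, (q : ℝ) < a ∧ ∃ᶠ n in atTop, birkhoffAverage ℝ T g n x < q) ∧
      ∃ q : ℚ, (q : ℝ) < -b ∧ ∃ᶠ n in atTop, birkhoffAverage ℝ T (-g) n x < q) := by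
    simp only [ae_all_iff]
    exact fun a b hab => hT.ae_not_birkhoffAverage_upcrossing hgm hC hab
  filter_upwards [h] with x hx
  have hbd : ∀ n, |birkhoffAverage ℝ T g n x| ≤ C := by
    intro n
    have hC0 : 0 ≤ C := (abs_nonneg _).trans (hC x)
    rcases n.eq_zero_or_pos with rfl | hn
    · simpa using hC0
    have hn0 : (0 : ℝ) < n := by exact_mod_cast hn
    rw [birkhoffAverage, smul_eq_mul, abs_mul, abs_inv, Nat.abs_cast, inv_mul_le_iff₀ hn0]
    refine (Finset.abs_sum_le_sum_abs _ _).trans ?_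
    simpa using Finset.sum_le_sum fun k (_ : k ∈ Finset.range n) => hC (T^[k] x)
  refine tendsto_of_no_upcrossings Rat.isDenseEmbedding_coe_real.dense ?_
    (isBoundedUnder_of ⟨C, fun n => (abs_le.1 (hbd n)).2⟩)
    (isBoundedUnder_of ⟨-C, fun n => (abs_le.1 (hbd n)).1⟩)
  rintro _ ⟨a, rfl⟩ _ ⟨b, rfl⟩ hab ⟨h1, h2⟩
  -- Shrinking the gap to `a' < b'` leaves `a` and `-b` as the strict rational witnesses.
  obtain ⟨a', ha, hab'⟩ := exists_rat_btwn hab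
  obtain ⟨b', ha', hb'⟩ := exists_rat_btwn hab'
  refine hx a' b' ha' ⟨⟨a, ha, h1⟩, -b, by push_cast; linarith, h2.mono fun n hn => ?_⟩
  rw [birkhoffAverage_neg]
  push_cast
  exact neg_lt_neg hn

/-- Birkhoff's ergodic theorem for essentially bounded functions: the averages converge a.e. -/
theorem MeasureTheory.MeasurePreserving.ae_exists_tendsto_birkhoffAverage
    [IsFiniteMeasure μ] (hT : MeasurePreserving T μ μ) (hgm : Measurable g) {C : ℝ}
    (hC : ∀ᵐ x ∂μ, |g x| ≤ C) :
    ∀ᵐ x ∂μ, ∃ l, Tendsto (fun n => birkhoffAverage ℝ T g n x) atTop (𝓝 l) := by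
  -- Truncation makes the bound hold everywhere and changes nothing along almost every orbit.
  have hb : ∀ x, |max (-|C|) (min (g x) |C|)| ≤ |C| := fun x =>
    abs_le.2 ⟨le_max_left _ _, max_le (by linarith [abs_nonneg C]) (min_le_right _ _)⟩
  have horb : ∀ᵐ x ∂μ, ∀ n, |g (T^[n] x)| ≤ C :=
    ae_all_iff.2 fun n => (hT.iterate n).quasiMeasurePreserving.ae hC
  filter_upwards [hT.ae_exists_tendsto_birkhoffAverage_of_forall_le
    (measurable_const.max (hgm.min measurable_const)) hb, horb] with x ⟨l, hl⟩ hx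
  refine ⟨l, hl.congr fun n => ?_⟩
  simp only [birkhoffAverage, birkhoffSum]
  congr 1
  refine Finset.sum_congr rfl fun k _ => ?_
  have := abs_le.1 ((hx k).trans (le_abs_self C))
  rw [min_eq_left this.2, max_eq_right this.1]

end Birkhoff

/-! ### Invariant measures of continuous maps on compact spaces. -/

section KrylovBogoliubov

variable {X : Type*} [TopologicalSpace X] [MeasurableSpace X]

/-- The uniform probability measure on the first `n + 1` points of the orbit of `x`. -/
noncomputable def orbitMeasure (T : X → X) (x : X) (n : ℕ) : ProbabilityMeasure X :=
  ⟨((n + 1 : ℕ) : ENNReal)⁻¹ • ∑ k ∈ Finset.range (n + 1), Measure.dirac (T^[k] x), ⟨by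
    simp only [Measure.smul_apply, Measure.finsetSum_apply, measure_univ, Finset.sum_const,
      Finset.card_range, nsmul_eq_mul, mul_one, smul_eq_mul]
    exact ENNReal.inv_mul_cancel (by simp) (ENNReal.natCast_ne_top _)⟩⟩

theorem integral_orbitMeasure [OpensMeasurableSpace X] (T : X → X) (x : X) (n : ℕ)
    (f : BoundedContinuousFunction X ℝ) :
    ∫ y, f y ∂(orbitMeasure T x n : Measure X) = birkhoffAverage ℝ T f (n + 1) x := by
  have hf : ∀ y, Integrable f (Measure.dirac y) := fun y => f.integrable _
  simp only [orbitMeasure, ProbabilityMeasure.coe_mk]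
  rw [integral_smul_measure, integral_finsetSum_measure fun k _ => hf _]
  simp [birkhoffAverage, birkhoffSum, integral_dirac' _ _ f.continuous.stronglyMeasurable,
    ENNReal.toReal_add]

/-- The Krylov–Bogoliubov theorem. -/
theorem exists_measurePreserving_of_continuous {X : Type*} [MetricSpace X] [CompactSpace X]
    [MeasurableSpace X] [BorelSpace X] [Nonempty X] {T : X → X} (hT : Continuous T) :
    ∃ μ : Measure X, IsProbabilityMeasure μ ∧ MeasurePreserving T μ μ := by
  obtain ⟨x⟩ := ‹Nonempty X›
  -- An ultrafilter finer than `atTop` replaces the extraction of a weakly convergent subsequence.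
  let F : Ultrafilter (ProbabilityMeasure X) :=
    Ultrafilter.map (orbitMeasure T x) (Ultrafilter.of atTop)
  obtain ⟨μ, -, hμ⟩ := isCompact_univ.ultrafilter_le_nhds F (by simp)
  have hlim : Tendsto (orbitMeasure T x) (Ultrafilter.of (atTop : Filter ℕ)) (𝓝 μ) := hμ
  rw [ProbabilityMeasure.tendsto_iff_forall_integral_tendsto] at hlim
  refine ⟨μ, inferInstance, hT.measurable, ?_⟩
  have : IsProbabilityMeasure (Measure.map T (μ : Measure X)) :=
    Measure.isProbabilityMeasure_map hT.measurable.aemeasurable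
  refine ext_of_forall_integral_eq_of_IsFiniteMeasure fun f => ?_
  rw [integral_map hT.measurable.aemeasurable f.continuous.aestronglyMeasurable]
  have h1 := hlim f
  have h2 := hlim (f.compContinuous ⟨T, hT⟩)
  have h3 : Tendsto (fun n => birkhoffAverage ℝ T f (n + 1) (T x) -
      birkhoffAverage ℝ T f (n + 1) x) (Ultrafilter.of (atTop : Filter ℕ)) (𝓝 0) := by
    refine Tendsto.mono_left ?_ (Ultrafilter.of_le _)
    refine (tendsto_birkhoffAverage_apply_sub_birkhoffAverage ℝ ?_).comp (tendsto_add_atTop_nat 1)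
    exact f.isBounded_range.subset (by rintro _ ⟨n, rfl⟩; exact ⟨_, rfl⟩)
  simp only [integral_orbitMeasure] at h1 h2
  have h4 : ∀ n, birkhoffAverage ℝ T (f.compContinuous ⟨T, hT⟩) n x =
      birkhoffAverage ℝ T f n (T x) := fun n => by
    simp only [birkhoffAverage, birkhoffSum, BoundedContinuousFunction.compContinuous_apply,
      ContinuousMap.coe_mk, ← Function.iterate_succ_apply' T, Function.iterate_succ_apply]
  simp only [h4] at h2
  exact sub_eq_zero.1 (tendsto_nhds_unique (h2.sub h1) h3)

end KrylovBogoliubov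

/-! ### Elementary properties of the update. -/

namespace AdaBoost

variable {m : ℕ} {M : Finset (Row m)} {sel : Finset (Row m) → Row m}

theorem Row.val_nonneg (η : Row m) (i : Fin m) : 0 ≤ η.val i := Nat.cast_nonneg _

theorem Row.val_le_one (η : Row m) (i : Fin m) : η.val i ≤ 1 := by
  have : (η i : ℕ) ≤ 1 := by omega
  rw [Row.val]
  exact_mod_cast this

theorem continuous_err (η : Row m) : Continuous (err η) := by
  unfold err
  fun_prop

theorem err_nonneg {w : Fin m → ℝ} (hw : w ∈ stdSimplex ℝ (Fin m)) (η : Row m) : 0 ≤ err η w :=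
  Finset.sum_nonneg fun i _ => mul_nonneg (η.val_nonneg i) (hw.1 i)

theorem argminRows_subset (M : Finset (Row m)) (w : Fin m → ℝ) : argminRows M w ⊆ M :=
  Finset.filter_subset _ _

theorem mem_argminRows {w : Fin m → ℝ} {η : Row m} :
    η ∈ argminRows M w ↔ η ∈ M ∧ ∀ η' ∈ M, err η w ≤ err η' w := by
  simp [argminRows]

theorem argminRows_nonempty (hM : M.Nonempty) (w : Fin m → ℝ) : (argminRows M w).Nonempty := by
  obtain ⟨η, hη, h⟩ := M.exists_min_image (fun η => err η w) hM
  exact ⟨η, mem_argminRows.2 ⟨hη, h⟩⟩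

theorem bestRow_mem_argminRows (hM : M.Nonempty) (hsel : IsAdaSelect M sel) (w : Fin m → ℝ) :
    bestRow M sel w ∈ argminRows M w :=
  hsel _ (argminRows_subset M w) (argminRows_nonempty hM w)

theorem bestRow_mem (hM : M.Nonempty) (hsel : IsAdaSelect M sel) (w : Fin m → ℝ) :
    bestRow M sel w ∈ M :=
  argminRows_subset M w (bestRow_mem_argminRows hM hsel w)

theorem minErr_eq_err (hM : M.Nonempty) {w : Fin m → ℝ} {η : Row m} (hη : η ∈ argminRows M w) :
    minErr M hM w = err η w := by
  rw [mem_argminRows] at hη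
  exact le_antisymm (Finset.inf'_le _ hη.1) (Finset.le_inf' _ _ hη.2)

theorem hypUpdate_apply (η : Row m) (w : Fin m → ℝ) (i : Fin m) :
    hypUpdate η w i = 1 / 2 * (η.val i * w i / err η w + (1 - η.val i) * w i / (1 - err η w)) := by
  obtain h | h : η i = 0 ∨ η i = 1 := by omega
  all_goals
    simp only [hypUpdate, Row.val, h]
    simp
    ring

/-- Each misclassified weight is divided by `2 * err η w`, and only these enter the error. -/
theorem err_hypUpdate (η : Row m) {w : Fin m → ℝ} (h0 : err η w ≠ 0) :
    err η (hypUpdate η w) = 1 / 2 := by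
  have : ∀ i, η.val i * hypUpdate η w i = (2 * err η w)⁻¹ * (η.val i * w i) := by
    intro i
    rw [hypUpdate_apply]
    obtain h | h : η i = 0 ∨ η i = 1 := by omega
    all_goals
      simp only [Row.val, h]
      simp
      try ring
  rw [err, Finset.sum_congr rfl fun i _ => this i, ← Finset.mul_sum]
  change (2 * err η w)⁻¹ * err η w = _
  field_simp

/-- Both factors are 1/2 divided by a number in (0, 1). Hence no row's error can drop by more than
half in one round. -/
theorem half_le_hypUpdate {η : Row m} {w : Fin m → ℝ} (hw : w ∈ stdSimplex ℝ (Fin m))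
    (h0 : 0 < err η w) (h1 : err η w < 1) (i : Fin m) : 1 / 2 * w i ≤ hypUpdate η w i := by
  have a : w i ≤ w i / err η w := le_div_self (hw.1 i) h0 h1.le
  have b : w i ≤ w i / (1 - err η w) := le_div_self (hw.1 i) (by linarith) (by linarith)
  rw [hypUpdate_apply, mul_div_assoc, mul_div_assoc]
  nlinarith [mul_le_mul_of_nonneg_left a (η.val_nonneg i),
    mul_le_mul_of_nonneg_left b (sub_nonneg.2 (η.val_le_one i))]

theorem hypUpdate_mem_stdSimplex {η : Row m} {w : Fin m → ℝ} (hw : w ∈ stdSimplex ℝ (Fin m))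
    (h0 : 0 < err η w) (h1 : err η w < 1) : hypUpdate η w ∈ stdSimplex ℝ (Fin m) := by
  refine ⟨fun i => (mul_nonneg (by norm_num) (hw.1 i)).trans (half_le_hypUpdate hw h0 h1 i), ?_⟩
  have h2 : ∑ i, (1 - η.val i) * w i = 1 - err η w := by
    simp only [sub_mul, one_mul, Finset.sum_sub_distrib, hw.2, err]
  simp only [hypUpdate_apply]
  rw [← Finset.mul_sum, Finset.sum_add_distrib, ← Finset.sum_div, ← Finset.sum_div, h2]
  change 1 / 2 * (err η w / err η w + _) = 1
  rw [div_self h0.ne', div_self (by linarith)]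
  norm_num

theorem err_bestRow_lt (hM : M.Nonempty) (hsel : IsAdaSelect M sel) {γ : ℝ} {w : Fin m → ℝ}
    (hγ : ∃ η ∈ M, err η w < 1 / 2 - γ) : err (bestRow M sel w) w < 1 / 2 - γ := by
  obtain ⟨η, hη, h⟩ := hγ
  exact ((mem_argminRows.1 (bestRow_mem_argminRows hM hsel w)).2 η hη).trans_lt h

theorem weight_succ (w : Fin m → ℝ) (t : ℕ) :
    weight M sel w (t + 1) = update M sel (weight M sel w t) :=
  Function.iterate_succ_apply' _ _ _

/-! ### Uniform lower bound on the errors. -/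

section WeakLearning

variable (hM : M.Nonempty) (hsel : IsAdaSelect M sel) (hweak : WeakLearning M)
include hM hsel hweak

theorem err_bestRow_mem_Ioo {w : Fin m → ℝ} (hw : w ∈ posErr M) :
    err (bestRow M sel w) w ∈ Set.Ioo 0 (1 / 2) := by
  obtain ⟨γ, hγ, h⟩ := hweak
  exact ⟨hw.2 _ (bestRow_mem hM hsel w), by linarith [err_bestRow_lt hM hsel (h w hw.1)]⟩

theorem half_le_update {w : Fin m → ℝ} (hw : w ∈ posErr M) (i : Fin m) :
    1 / 2 * w i ≤ update M sel w i :=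
  have h := err_bestRow_mem_Ioo hM hsel hweak hw
  half_le_hypUpdate hw.1 h.1 (by linarith [h.2]) i

theorem half_err_le_err_update {w : Fin m → ℝ} (hw : w ∈ posErr M) (η : Row m) :
    1 / 2 * err η w ≤ err η (update M sel w) := by
  rw [err, Finset.mul_sum]
  refine Finset.sum_le_sum fun i _ => ?_
  nlinarith [mul_le_mul_of_nonneg_left (half_le_update hM hsel hweak hw i) (η.val_nonneg i)]

theorem err_bestRow_update {w : Fin m → ℝ} (hw : w ∈ posErr M) :
    err (bestRow M sel w) (update M sel w) = 1 / 2 :=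
  err_hypUpdate _ (err_bestRow_mem_Ioo hM hsel hweak hw).1.ne'

theorem mapsTo_update_posErr : Set.MapsTo (update M sel) (posErr M) (posErr M) := fun w hw => by
  have h := err_bestRow_mem_Ioo hM hsel hweak hw
  refine ⟨hypUpdate_mem_stdSimplex hw.1 h.1 (by linarith [h.2]), fun η hη => ?_⟩
  linarith [hw.2 η hη, half_err_le_err_update hM hsel hweak hw η]

theorem weight_mem_posErr {w : Fin m → ℝ} (hw : w ∈ posErr M) (t : ℕ) :
    weight M sel w t ∈ posErr M :=
  (mapsTo_update_posErr hM hsel hweak).iterate t hw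

theorem pow_mul_err_le {w : Fin m → ℝ} (hw : w ∈ posErr M) (η : Row m) (s k : ℕ) :
    (1 / 2) ^ k * err η (weight M sel w s) ≤ err η (weight M sel w (s + k)) := by
  induction k with
  | zero => simp
  | succ k ih =>
    have := half_err_le_err_update hM hsel hweak
      (weight_mem_posErr hM hsel hweak hw (s + k)) η
    rw [← add_assoc, weight_succ, pow_succ]
    linarith

/-- After as many updates as there are rows, the errors are bounded away from zero. -/
theorem pow_le_err_weight_card {w : Fin m → ℝ} (hw : w ∈ posErr M) {η : Row m} (hη : η ∈ M) :
    (1 / 2) ^ (M.card + 1) ≤ err η (weight M sel w M.card) := by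
  by_contra! hlt
  -- Errors at most halve per round, so a small error at the end forces small errors earlier.
  have hdecay : ∀ s ≤ M.card, err η (weight M sel w s) < (1 / 2) ^ (s + 1) := fun s hs => by
    have h := (pow_mul_err_le hM hsel hweak hw η s (M.card - s)).trans_lt
      (by rwa [Nat.add_sub_cancel' hs])
    rw [show M.card + 1 = (M.card - s) + (s + 1) by omega, pow_add] at h
    exact lt_of_mul_lt_mul_left h (by positivity)
  -- Some row is selected at two rounds `s < t`. Its error is 1/2 just after round `s`, hence at
  -- least `(1/2) ^ (t - s)` at round `t`, where it is minimal; this contradicts the bound `(1/2) ^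
  -- (t + 1)` on the error of `η`.
  obtain ⟨s, hs, t, ht, hne, heq⟩ := Finset.exists_ne_map_eq_of_card_lt_of_maps_to
    (s := Finset.range (M.card + 1)) (t := M) (by simp)
    (f := fun t => bestRow M sel (weight M sel w t)) (fun t _ => bestRow_mem hM hsel _)
  rw [Finset.mem_range] at hs ht
  wlog hst : s < t generalizing s t
  · exact this t ht s hs hne.symm heq.symm (by omega)
  obtain ⟨k, rfl⟩ := Nat.exists_eq_add_of_lt hst
  have h1 := err_bestRow_update hM hsel hweak (weight_mem_posErr hM hsel hweak hw s)
  have h2 := pow_mul_err_le hM hsel hweak hw (bestRow M sel (weight M sel w s)) (s + 1) k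
  rw [weight_succ, h1, heq,
    show s + 1 + k = s + k + 1 by ring] at h2
  have h3 := (mem_argminRows.1 (bestRow_mem_argminRows hM hsel
    (weight M sel w (s + k + 1)))).2 η hη
  have h4 := hdecay (s + k + 1) (by omega)
  have h5 : (1 / 2 : ℝ) ^ (s + k + 1 + 1) ≤ (1 / 2) ^ k * (1 / 2) := by
    rw [← pow_succ]
    exact pow_le_pow_of_le_one (by norm_num) (by norm_num) (by omega)
  linarith

end WeakLearning

/-! ### Measurability. -/

theorem measurable_of_forall_eq {α β : Type*} [MeasurableSpace α] (f : Row m → α → β)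
    [MeasurableSpace β] (hf : ∀ η, Measurable (f η)) {b : α → Row m} (hb : Measurable b) :
    Measurable fun x => f (b x) x :=
  (measurable_from_prod_countable_right (f := fun p : Row m × α => f p.1 p.2) hf).comp
    (hb.prodMk measurable_id)

theorem measurable_bestRow : Measurable (bestRow M sel) := by
  have hs : ∀ s, MeasurableSet {w | argminRows M w = s} := fun s => by
    simp only [Finset.ext_iff, mem_argminRows]
    refine measurableSet_setOfPred.2 (Measurable.forall fun η => Measurable.iff
      (measurable_const.and (Measurable.forall fun η' => measurable_const.imp ?_))
      measurable_const)
    exact measurableSet_setOfPred.1 (measurableSet_le (continuous_err η).measurable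
      (continuous_err η').measurable)
  refine measurable_to_countable' fun η => ?_
  have : bestRow M sel ⁻¹' {η} = ⋃ s ∈ {s | sel s = η}, {w | argminRows M w = s} := by
    ext w
    simp [bestRow]
  rw [this]
  exact MeasurableSet.biUnion (Set.to_countable _) fun s _ => hs s

theorem measurable_hypUpdate (η : Row m) : Measurable (hypUpdate η) := by
  have := (continuous_err η).measurable
  refine measurable_pi_lambda _ fun i => ?_
  unfold hypUpdate
  fun_prop

theorem measurable_update : Measurable (update M sel) :=
  measurable_of_forall_eq hypUpdate measurable_hypUpdate measurable_bestRow

theorem measurable_coeff (hM : M.Nonempty) : Measurable (coeff M hM) := by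
  have : Measurable (minErr M hM) :=
    (Continuous.finset_inf'_apply hM fun η _ => continuous_err η).measurable
  unfold coeff
  fun_prop

/-! ### Existence of an invariant measure. -/

section Existence

theorem hypUpdate_congr {η η' : Row m} {w : Fin m → ℝ} (h : ∀ i, η i ≠ η' i → w i = 0) :
    hypUpdate η w = hypUpdate η' w := by
  have hv : ∀ i, η.val i * w i = η'.val i * w i := fun i => by
    by_cases hi : η i = η' i
    · simp [Row.val, hi]
    · simp [h i hi]
  have he : err η w = err η' w := Finset.sum_congr rfl fun i _ => hv i
  ext i
  rw [hypUpdate_apply, hypUpdate_apply, he, hv, sub_mul, hv, sub_mul]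

theorem continuousAt_hypUpdate {η : Row m} {w : Fin m → ℝ} (h0 : err η w ≠ 0)
    (h1 : err η w ≠ 1) : ContinuousAt (hypUpdate η) w := by
  have := (continuous_err η).continuousAt (x := w)
  have h1' : 1 - err η w ≠ 0 := sub_ne_zero.2 h1.symm
  refine continuousAt_pi.2 fun i => ?_
  simp only [hypUpdate_apply]
  have hi : ContinuousAt (fun v : Fin m → ℝ => v i) w := (continuous_apply i).continuousAt
  exact continuousAt_const.mul (((continuousAt_const.mul hi).div this h0).add
    ((continuousAt_const.mul hi).div (continuousAt_const.sub this) h1'))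

/-- A row strictly beaten at `w` stays beaten nearby, since strict inequalities of continuous
functions are open. -/
theorem eventually_argminRows_subset (w : Fin m → ℝ) :
    ∀ᶠ w' in 𝓝 w, argminRows M w' ⊆ argminRows M w := by
  have : ∀ η ∈ M, ∀ᶠ w' in 𝓝 w, η ∈ argminRows M w' → η ∈ argminRows M w := fun η hη => by
    by_cases h : η ∈ argminRows M w
    · exact Eventually.of_forall fun _ _ => h
    · have h' := h
      rw [mem_argminRows, not_and] at h'
      push Not at h'
      obtain ⟨η', hη', hlt⟩ := h' hη
      filter_upwards [(continuous_err η').continuousAt.eventually_lt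
        (continuous_err η).continuousAt hlt] with w' hw' hmem
      exact absurd ((mem_argminRows.1 hmem).2 η' hη') (not_le.2 hw')
  filter_upwards [(M.eventually_all).2 this] with w' hw' η hη
  exact hw' η (argminRows_subset M w' hη) hη

theorem limitSet_subset {t : ℕ} (ht : 1 ≤ t) :
    limitSet M sel ⊆ (update M sel)^[t] '' posErr M :=
  Set.biInter_subset_of_mem ht

variable (hM : M.Nonempty) (hsel : IsAdaSelect M sel) (hweak : WeakLearning M)
include hM hsel hweak

/-- A row selected near `w` is also minimal at `w`, so it ties there with the row selected at `w`.
The tie hypothesis makes the two differ only on coordinates vanishing on `G`, so their updates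
agree, and `update` coincides near `w` in `K` with a single continuous `hypUpdate`. -/
theorem continuousOn_update {G K : Set (Fin m → ℝ)} (hG : G ⊆ stdSimplex ℝ (Fin m))
    (hties : ∀ η ∈ M, ∀ η' ∈ M, region M η ∩ region M η' ∩ G = ∅ ∨
      ∀ w ∈ G, ∑ i with η i ≠ η' i, w i = 0)
    (hKG : K ⊆ G) (hK : K ⊆ posErr M) : ContinuousOn (update M sel) K := by
  intro w hw
  have he := err_bestRow_mem_Ioo hM hsel hweak (hK hw)
  have hc : ContinuousWithinAt (hypUpdate (bestRow M sel w)) K w :=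
    (continuousAt_hypUpdate he.1.ne' (by linarith [he.2])).continuousWithinAt
  refine hc.congr_of_eventuallyEq ?_ rfl
  filter_upwards [self_mem_nhdsWithin, mem_nhdsWithin_of_mem_nhds
    (eventually_argminRows_subset (M := M) w)] with w' hw' hsub
  have h1 := hsub (bestRow_mem_argminRows hM hsel w')
  have h2 := bestRow_mem_argminRows hM hsel w
  have hS := hG (hKG hw)
  rcases hties _ (argminRows_subset M w h1) _ (argminRows_subset M w h2) with h | h
  · exact (Set.eq_empty_iff_forall_notMem.1 h w ⟨⟨⟨hS, h1⟩, hS, h2⟩, hKG hw⟩).elim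
  · refine hypUpdate_congr fun i hi => ?_
    exact (Finset.sum_eq_zero_iff_of_nonneg fun j _ => (hG (hKG hw')).1 j).1 (h w' (hKG hw')) i
      (by simpa using hi)

theorem mapsTo_update_limitSet : Set.MapsTo (update M sel) (limitSet M sel) (limitSet M sel) := by
  intro w hw
  refine Set.mem_iInter₂.2 fun t ht => ?_
  obtain ⟨v, hv, rfl⟩ := limitSet_subset ht hw
  exact ⟨update M sel v, mapsTo_update_posErr hM hsel hweak hv,
    (Function.iterate_succ_apply _ _ _).symm.trans (Function.iterate_succ_apply' _ _ _)⟩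

theorem exists_isInvariant (hties : NoTies M sel) (hne : (limitSet M sel).Nonempty) :
    ∃ μ : Measure (Fin m → ℝ), IsInvariant M sel μ := by
  obtain ⟨G, hG, hGc, hGsub, hGties⟩ := hties
  set K := closure (limitSet M sel)
  have hKG : K ⊆ G := closure_minimal hGsub hGc.isClosed
  have hKpos : K ⊆ posErr M := by
    have h1 : K ⊆ {w | ∀ η ∈ M, (1 / 2) ^ (M.card + 1) ≤ err η w} := by
      refine closure_minimal (fun w hw η hη => ?_) ?_
      -- Every limit point has an `M.card`-step past in `posErr M`, so the uniform bound applies to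
      -- it.
      · obtain ⟨v, hv, rfl⟩ := limitSet_subset (Finset.card_pos.2 hM) hw
        exact pow_le_err_weight_card hM hsel hweak hv hη
      · simp only [Set.ofPred_forall]
        exact isClosed_biInter fun η _ => isClosed_le continuous_const (continuous_err η)
    exact fun w hw => ⟨hG (hKG hw), fun η hη => lt_of_lt_of_le (by positivity) (h1 hw η hη)⟩
  have hc := continuousOn_update hM hsel hweak hG hGties hKG hKpos
  have hmaps : Set.MapsTo (update M sel) K K :=
    (mapsTo_update_limitSet hM hsel hweak).closure_of_continuousOn hc
  have : CompactSpace K := isCompact_iff_compactSpace.1 (hGc.of_isClosed_subset isClosed_closure hKG)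
  have : Nonempty K := (hne.mono subset_closure).to_subtype
  obtain ⟨ν, hν, hpres⟩ := exists_measurePreserving_of_continuous (hc.mapsToRestrict hmaps)
  refine ⟨ν.map Subtype.val, Measure.isProbabilityMeasure_map measurable_subtype_coe.aemeasurable,
    ?_, measurable_update, ?_⟩
  · have hKm : MeasurableSet K := isClosed_closure.measurableSet
    have : ∀ᵐ w ∂ν.map Subtype.val, w ∈ K :=
      (ae_map_iff measurable_subtype_coe.aemeasurable hKm).2 (Eventually.of_forall Subtype.prop)
    exact this.mono fun w hw => hKpos hw
  · rw [Measure.map_map measurable_update measurable_subtype_coe]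
    conv_rhs => rw [← hpres.map_eq]
    rw [Measure.map_map measurable_subtype_coe hpres.measurable]
    rfl

end Existence

/-! ### Convergence of the weighted row frequencies. -/

section Convergence

theorem coeff_bounds (hM : M.Nonempty) (hsel : IsAdaSelect M sel) {γ δ : ℝ} (hδ : 0 < δ)
    (hγ : 0 < γ) {w : Fin m → ℝ} (hw : ∃ η ∈ M, err η w < 1 / 2 - γ)
    (hle : ∀ η ∈ M, δ ≤ err η w) :
    1 / 2 * Real.log ((1 / 2 + γ) / (1 / 2 - γ)) ≤ coeff M hM w ∧
      coeff M hM w ≤ 1 / 2 * Real.log (1 / δ) := by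
  have h1 := err_bestRow_lt hM hsel hw
  have h2 := hle _ (bestRow_mem hM hsel w)
  rw [coeff, minErr_eq_err hM (bestRow_mem_argminRows hM hsel w)]
  set e := err (bestRow M sel w) w
  have he : 0 < e := by linarith
  constructor
  · gcongr
    · exact div_pos (by linarith) (by linarith)
    · linarith
    · linarith
  · gcongr
    · exact div_pos (by linarith) (by linarith)
    · linarith

theorem log_pos_of_weakLearning {γ : ℝ} (hγ : 0 < γ) (hγ' : γ < 1 / 2) :
    0 < 1 / 2 * Real.log ((1 / 2 + γ) / (1 / 2 - γ)) := by
  have : 1 < (1 / 2 + γ) / (1 / 2 - γ) := by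
    rw [one_lt_div (by linarith)]
    linarith
  have := Real.log_pos this
  positivity

/-- `coeff M hM w` if the row `η` is selected at `w`, and `0` otherwise. -/
noncomputable def rowCoeff (M : Finset (Row m)) (hM : M.Nonempty)
    (sel : Finset (Row m) → Row m) (η : Row m) (w : Fin m → ℝ) : ℝ :=
  if bestRow M sel w = η then coeff M hM w else 0

theorem measurable_rowCoeff (hM : M.Nonempty) (η : Row m) :
    Measurable (rowCoeff M hM sel η) :=
  Measurable.ite (measurable_bestRow (measurableSet_singleton η)) (measurable_coeff hM)
    measurable_const

theorem sum_rowCoeff_mul (hM : M.Nonempty) (hsel : IsAdaSelect M sel) (f : Row m → ℝ)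
    (w : Fin m → ℝ) :
    ∑ η ∈ M, rowCoeff M hM sel η w * f η = coeff M hM w * f (bestRow M sel w) := by
  simp [rowCoeff, bestRow_mem hM hsel w]

/-- If the frequencies of the rows, weighted by the coefficients, converge, then so do all
weighted averages of functions of the selected row. -/
theorem tendsto_sum_mul_inv_coeffSum (hM : M.Nonempty) (hsel : IsAdaSelect M sel)
    {w : Fin m → ℝ} {L : Row m → ℝ}
    (hL : ∀ η, Tendsto (fun n => birkhoffAverage ℝ (update M sel) (rowCoeff M hM sel η) n w)
      atTop (𝓝 (L η))) (hpos : ∑ η ∈ M, L η ≠ 0) (f : Row m → ℝ) :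
    Tendsto (fun T => (∑ t ∈ Finset.range T, coeff M hM (weight M sel w t) *
      f (bestRow M sel (weight M sel w t))) * (coeffSum M hM sel w T)⁻¹) atTop
      (𝓝 (∑ η ∈ M, L η / (∑ η ∈ M, L η) * f η)) := by
  have key : ∀ f : Row m → ℝ, Tendsto (fun T : ℕ => (T : ℝ)⁻¹ * ∑ t ∈ Finset.range T,
      coeff M hM (weight M sel w t) * f (bestRow M sel (weight M sel w t))) atTop
      (𝓝 (∑ η ∈ M, L η * f η)) := fun f => by
    refine (tendsto_finsetSum M fun η _ => (hL η).mul_const (f η)).congr fun T => ?_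
    simp only [birkhoffAverage, birkhoffSum, smul_eq_mul, mul_assoc, ← Finset.mul_sum]
    simp only [← sum_rowCoeff_mul hM hsel, Finset.sum_mul, weight]
    rw [Finset.sum_comm]
  have h1 := key fun _ => 1
  simp only [mul_one] at h1
  have h2 := (key f).div h1 hpos
  rw [Finset.sum_div] at h2
  simp only [div_mul_eq_mul_div]
  refine h2.congr' ?_
  filter_upwards [eventually_gt_atTop 0] with T hT
  have hT0 : (T : ℝ)⁻¹ ≠ 0 := inv_ne_zero (by exact_mod_cast hT.ne')
  rw [Pi.div_apply, mul_div_mul_left _ _ hT0, coeffSum, div_eq_mul_inv]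

theorem IsInvariant.ae_exists_tendsto (hM : M.Nonempty) (hsel : IsAdaSelect M sel)
    (hweak : WeakLearning M) {μ : Measure (Fin m → ℝ)} (hμ : IsInvariant M sel μ) :
    ∀ᵐ w ∂μ, ∃ L : Row m → ℝ, (∀ η, 0 ≤ L η) ∧ 0 < ∑ η ∈ M, L η ∧
      ∀ η, Tendsto (fun n => birkhoffAverage ℝ (update M sel) (rowCoeff M hM sel η) n w)
        atTop (𝓝 (L η)) := by
  have := hμ.prob
  have hpres := hμ.preserving
  obtain ⟨γ, hγ, hγw⟩ := hweak
  set c := 1 / 2 * Real.log ((1 / 2 + γ) / (1 / 2 - γ))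
  set δ : ℝ := (1 / 2) ^ (M.card + 1)
  have hδ : ∀ᵐ w ∂μ, ∀ η ∈ M, δ ≤ err η w := by
    have hm : MeasurableSet {w | ∀ η ∈ M, δ ≤ err η w} := by
      simp only [Set.ofPred_forall]
      exact (isClosed_biInter fun η _ =>
        isClosed_le continuous_const (continuous_err η)).measurableSet
    -- Invariance turns a bound valid after `M.card` updates into one valid almost everywhere now.
    rw [← (hpres.iterate M.card).map_eq, ae_map_iff (hpres.iterate _).measurable.aemeasurable hm]
    exact hμ.carried.mono fun w hw η hη =>
      pow_le_err_weight_card hM hsel ⟨γ, hγ, hγw⟩ hw hη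
  have hbd : ∀ᵐ w ∂μ, c ≤ coeff M hM w ∧ coeff M hM w ≤ 1 / 2 * Real.log (1 / δ) := by
    filter_upwards [hδ, hμ.carried] with w h1 h2
    exact coeff_bounds hM hsel (by positivity) hγ (hγw w h2.1) h1
  -- Positivity of `c` needs `γ < 1/2`, which follows from a nonnegative error at any point of the
  -- simplex.
  have hc : ∀ᵐ w ∂μ, 0 < c := hμ.carried.mono fun w hw => by
    obtain ⟨η, -, hη⟩ := hγw w hw.1
    exact log_pos_of_weakLearning hγ (by linarith [err_nonneg hw.1 η])
  have hrow : ∀ η, ∀ᵐ w ∂μ, |rowCoeff M hM sel η w| ≤ 1 / 2 * Real.log (1 / δ) := fun η => by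
    filter_upwards [hbd, hc] with w h1 h2
    rw [rowCoeff]
    split_ifs
    · rw [abs_of_nonneg (h2.le.trans h1.1)]
      exact h1.2
    · rw [abs_zero]
      linarith
  have horb : ∀ᵐ w ∂μ, ∀ n, c ≤ coeff M hM ((update M sel)^[n] w) :=
    ae_all_iff.2 fun n => (hpres.iterate n).quasiMeasurePreserving.ae (hbd.mono fun w h => h.1)
  have hconv := ae_all_iff.2 fun η =>
    hpres.ae_exists_tendsto_birkhoffAverage (measurable_rowCoeff hM η) (hrow η)
  filter_upwards [hconv, horb, hc] with w h1 h2 h3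
  choose L hL using h1
  refine ⟨L, fun η => ge_of_tendsto' (hL η) fun n => ?_, ?_, hL⟩
  · refine mul_nonneg (by positivity) (Finset.sum_nonneg fun k _ => ?_)
    rw [rowCoeff]
    split_ifs
    · exact h3.le.trans (h2 k)
    · exact le_rfl
  -- Summed over rows, the averages become the average of `coeff`, which is at least `c`.
  · refine h3.trans_le (ge_of_tendsto (tendsto_finsetSum M fun η _ => hL η) ?_)
    filter_upwards [eventually_gt_atTop 0] with n hn
    have hn0 : (0 : ℝ) < n := by exact_mod_cast hn
    simp only [birkhoffAverage, birkhoffSum, smul_eq_mul, ← Finset.mul_sum]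
    rw [Finset.sum_comm, le_inv_mul_iff₀ hn0]
    have h4 : ∀ k, ∑ η ∈ M, rowCoeff M hM sel η ((update M sel)^[k] w) =
        coeff M hM ((update M sel)^[k] w) := fun k => by
      simpa using sum_rowCoeff_mul hM hsel (fun _ => 1) ((update M sel)^[k] w)
    simp only [h4]
    simpa using Finset.card_nsmul_le_sum (Finset.range n) _ c fun k _ => h2 k

end Convergence

end AdaBoost

theorem corollaryT {m : ℕ} (M : Finset (AdaBoost.Row m)) (hM : M.Nonempty)
    (sel : Finset (AdaBoost.Row m) → AdaBoost.Row m) (hsel : AdaBoost.IsAdaSelect M sel)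
    (hweak : AdaBoost.WeakLearning M)
    (hties : AdaBoost.NoTies M sel)
    (hne : (AdaBoost.limitSet M sel).Nonempty) :
    (∃ μ : Measure (Fin m → ℝ), AdaBoost.IsInvariant M sel μ) ∧
    ∀ μ : Measure (Fin m → ℝ), AdaBoost.IsInvariant M sel μ →
      ∀ᵐ w ∂μ, ∃ C : AdaBoost.Row m → ℝ,
        (∀ η ∈ M, 0 ≤ C η) ∧ ∑ η ∈ M, C η = 1 ∧
        ∀ i : Fin m,
          Tendsto (fun T => AdaBoost.margin M hM sel w T i) atTop
            (𝓝 (∑ η ∈ M, 2 * C η * (η.val i - 1))) ∧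
          Tendsto (fun T => AdaBoost.signedMargin M hM sel w T i) atTop
            (𝓝 (∑ η ∈ M, C η * (1 - 2 * η.val i))) := by
  refine ⟨AdaBoost.exists_isInvariant hM hsel hweak hties hne, fun μ hμ => ?_⟩
  filter_upwards [hμ.ae_exists_tendsto hM hsel hweak] with w ⟨L, h0, hpos, hL⟩
  refine ⟨fun η => L η / ∑ η ∈ M, L η, fun η _ => div_nonneg (h0 η) hpos.le, ?_, fun i => ⟨?_, ?_⟩⟩
  · rw [← Finset.sum_div, div_self hpos.ne']
  · have h := AdaBoost.tendsto_sum_mul_inv_coeffSum hM hsel hL hpos.ne'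
      fun η => 2 * (η.val i - 1)
    have hlim : ∑ η ∈ M, 2 * (L η / ∑ η ∈ M, L η) * (η.val i - 1) =
        ∑ η ∈ M, L η / (∑ η ∈ M, L η) * (2 * (η.val i - 1)) :=
      Finset.sum_congr rfl fun η _ => by ring
    rw [hlim]
    refine h.congr fun T => ?_
    rw [AdaBoost.margin, AdaBoost.score]
    congr 1
    exact Finset.sum_congr rfl fun t _ => by ring
  · exact AdaBoost.tendsto_sum_mul_inv_coeffSum hM hsel hL hpos.ne' fun η => 1 - 2 * η.val i
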